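/- Let $q_0$ be a prime power, $q=q_0^2$, and let $m$ be a divisor of $q_0+1$. Let $\mathcal X_m$ be the non-singular projective model over $\mathbb F_q$ of the plane curve $Y^m=X^{q_0}+X$, with function field $\mathbb F_q(x,y)$, $y^m=x^{q_0}+x$. Then the projective closure of the plane curve $Y^m=X^{q_0}+X$ has exactly one point at infinity (over the algebraic closure of $\mathbb F_q$; it is defined over $\mathbb F_q$), there is exactly one $\mathbb F_q$-rational point $\bar P_\infty$ of $\mathcal X_m$ centred at it, and $$\mathrm{ord}_{\bar P_\infty}(x)=-m,\qquad \mathrm{ord}_{\bar P_\infty}(y)=-q_0 .$$ -/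

import Mathlib

open Polynomial

noncomputable section

namespace PlaneCurve

/-! ### Places of a function field -/

/-- A place of the function field `K` of a curve over `k`: a valuation ring of `K` that contains
`k` and is different from `K`.  The places of `K` are the points of the non-singular projective
model over `k` of the curve. -/
structure Place (k K : Type*) [Field k] [Field K] [Algebra k K] where
  /-- The valuation ring (local ring) at the place. -/
  ring : ValuationSubring K
  algebraMap_mem : ∀ c : k, algebraMap k K c ∈ ring
  ne_top : ring ≠ ⊤

namespace Place

variable {k K : Type*} [Field k] [Field K] [Algebra k K]

/-- The map from the constants to the residue field of the place. -/
def constToResidue (P : Place k K) : k →+* IsLocalRing.ResidueField P.ring :=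
  (IsLocalRing.residue P.ring).comp
    ((algebraMap k K).codRestrict P.ring.toSubring P.algebraMap_mem)

/-- The place is `k`-rational: its residue field is `k`. -/
def IsRational (P : Place k K) : Prop :=
  Function.Bijective P.constToResidue

/-- `P.HasOrd f n` says that `f` has order `n` at `P`: the maximal ideal of the valuation ring
`O` of `P` is generated by some `t ≠ 0` (a uniformizer) and `f` is a unit of `O` times `t ^ n`.
Here `P.ring.valuation g < 1` says that `g` lies in the maximal ideal, and
`P.ring.valuation g ≤ P.ring.valuation t` says that `g` lies in `t O`. -/
def HasOrd (P : Place k K) (f : K) (n : ℤ) : Prop :=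
  ∃ t : K, t ≠ 0 ∧ (∀ g : K, P.ring.valuation g < 1 ↔ P.ring.valuation g ≤ P.ring.valuation t) ∧
    P.ring.valuation f = P.ring.valuation t ^ n

/-- The order of a function at a place is unique. -/
theorem HasOrd.unique {P : Place k K} {f : K} {n n' : ℤ}
    (h : P.HasOrd f n) (h' : P.HasOrd f n') : n = n' := by
  obtain ⟨t, ht, hg, hf⟩ := h
  obtain ⟨s, hs, hg', hf'⟩ := h'
  have hst : P.ring.valuation s = P.ring.valuation t :=
    le_antisymm ((hg s).1 ((hg' s).2 le_rfl)) ((hg' t).1 ((hg t).2 le_rfl))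
  rw [hst, hf] at hf'
  have h0 : 0 < P.ring.valuation t := zero_lt_iff.2 ((Valuation.ne_zero_iff _).2 ht)
  exact zpow_right_injective₀ h0 (ne_of_lt ((hg t).2 le_rfl)) hf'

/-- The place `P` is centred at the point `Q = (a : b : c)` of the projective plane over `k`, with
respect to the rational map `(x : y : 1)`: for some function `g`, the functions
`g x`, `g y`, `g` take the values `a`, `b`, `c` at `P`, that is, `g x - a`, `g y - b`, `g - c` lie
in the maximal ideal at `P`. -/
def IsCentredAt (P : Place k K) (x y : K) (Q : Projectivization k (Fin 3 → k)) : Prop :=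
  ∃ g : K, P.ring.valuation (g * x - algebraMap k K (Q.rep 0)) < 1 ∧
    P.ring.valuation (g * y - algebraMap k K (Q.rep 1)) < 1 ∧
    P.ring.valuation (g - algebraMap k K (Q.rep 2)) < 1

end Place

/-! ### The curve `Y ^ m = X ^ q₀ + X` -/

/-- The polynomial `Y ^ m - (X ^ q₀ + X)`, as a polynomial in `Y` over `k[X]`. -/
def equation (k : Type*) [Field k] (q₀ m : ℕ) : k[X][X] :=
  X ^ m - C (X ^ q₀ + X)

/-- The ring `k[X, Y] / (Y ^ m - (X ^ q₀ + X))` of regular functions on the affine curve. -/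
abbrev CoordinateRing (k : Type*) [Field k] (q₀ m : ℕ) : Type _ :=
  AdjoinRoot (equation k q₀ m)

/-- The coordinate function `x`. -/
def coordX (k : Type*) [Field k] (q₀ m : ℕ) : CoordinateRing k q₀ m :=
  AdjoinRoot.of (equation k q₀ m) X

/-- The coordinate function `y`. -/
def coordY (k : Type*) [Field k] (q₀ m : ℕ) : CoordinateRing k q₀ m :=
  AdjoinRoot.root (equation k q₀ m)

theorem equation_irreducible (k : Type*) [Field k] {q₀ m : ℕ} (hq : 1 < q₀) (hm : m ≠ 0) :
    Irreducible (equation k q₀ m) := by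
  have hmonic : (equation k q₀ m).Monic := monic_X_pow_sub_C _ hm
  have hdeg : (equation k q₀ m).natDegree = m := natDegree_X_pow_sub_C
  have hX : (Ideal.span {(X : k[X])}).IsPrime :=
    (Ideal.span_singleton_prime X_ne_zero).2 prime_X
  refine Polynomial.IsEisensteinAt.irreducible (𝓟 := Ideal.span {(X : k[X])})
    ⟨?_, ?_, ?_⟩ hX hmonic.isPrimitive (by omega)
  · rw [hmonic.leadingCoeff]
    exact fun h => hX.ne_top ((Ideal.eq_top_iff_one _).2 h)
  · intro n hn
    rw [hdeg] at hn
    rw [equation, coeff_sub, coeff_X_pow, if_neg hn.ne, zero_sub, coeff_C]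
    split_ifs
    · rw [neg_mem_iff, Ideal.mem_span_singleton]
      exact dvd_add (dvd_pow_self _ (by omega)) dvd_rfl
    · simp
  · rw [equation, coeff_sub, coeff_X_pow, if_neg hm.symm, zero_sub, coeff_C_zero, neg_mem_iff,
      Ideal.span_singleton_pow, Ideal.mem_span_singleton, X_pow_dvd_iff]
    intro h
    have := h 1 (by norm_num)
    rw [coeff_add, coeff_X_pow, if_neg (by omega), coeff_X_one] at this
    simp at this

/-- The affine curve is irreducible, so that it has a function field. -/
theorem coordinateRing_isDomain (k : Type*) [Field k] {q₀ m : ℕ} (hq : 1 < q₀) (hm : m ≠ 0) :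
    IsDomain (CoordinateRing k q₀ m) :=
  AdjoinRoot.isDomain_of_prime (equation_irreducible k hq hm).prime

/-- The homogeneous equation `Y ^ m Z ^ (d - m) - X ^ q₀ Z ^ (d - q₀) - X Z ^ (d - 1)`, where
`d = max m q₀`, of the projective closure of the affine curve `Y ^ m = X ^ q₀ + X`.
The coordinates `X`, `Y`, `Z` have the indices `0`, `1`, `2`. -/
def homogeneousEquation (L : Type*) [Field L] (q₀ m : ℕ) : MvPolynomial (Fin 3) L :=
  MvPolynomial.X 1 ^ m * MvPolynomial.X 2 ^ (max m q₀ - m) -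
    MvPolynomial.X 0 ^ q₀ * MvPolynomial.X 2 ^ (max m q₀ - q₀) -
    MvPolynomial.X 0 * MvPolynomial.X 2 ^ (max m q₀ - 1)

/-- `Q` is a point at infinity (a point with `Z = 0`) of the projective plane curve
`Y ^ m = X ^ q₀ + X`. -/
def IsPointAtInfinity {L : Type*} [Field L] (q₀ m : ℕ) (Q : Projectivization L (Fin 3 → L)) :
    Prop :=
  MvPolynomial.eval Q.rep (homogeneousEquation L q₀ m) = 0 ∧ Q.rep 2 = 0

/-- A point of the projective plane over `k`, seen as a point over the extension field `L`. -/
def baseChange (k L : Type*) [Field k] [Field L] [Algebra k L]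
    (Q : Projectivization k (Fin 3 → k)) : Projectivization L (Fin 3 → L) :=
  Projectivization.map (σ := algebraMap k L)
    { toFun := fun v i => algebraMap k L (v i)
      map_add' := fun v w => funext fun i => map_add _ (v i) (w i)
      map_smul' := fun c v => funext fun i => map_mul _ c (v i) }
    (fun _ _ h => funext fun i => (algebraMap k L).injective (congrFun h i)) Q

end PlaneCurve

end

/-! Write `q₀ + 1 = m * c` and put `u = 1 / x`, `v = y / x ^ c`. Dividing the equation by `x ^ (q₀ +
1)` gives `v ^ m = u ^ q₀ + u`, the same curve again, and `k(u, v) = k(x, y)` (`exists_algHom_inv`).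
A pole of `x` is a zero of `u`, hence also of `v`, so the poles of `x` are the places at the origin
of the `(u, v)`-curve.

The origin is a smooth point: `v ^ m = u * (1 + u ^ (q₀ - 1))` and the second factor is a unit
there. So there is exactly one place above it; it is rational, has uniformizer `v`, and `u` has
order `m` (`exists_place_origin`). Hence `x` has order `-m`, and `y = v * x ^ c` has order `1 - m *
c = -q₀`.

The point at infinity is `(0 : 1 : 0)` if `m < q₀` and `(1 : 0 : 0)` if `m > q₀`. A place centred at
it must be a pole of `x`, and comparing the two orders gives the converse. -/

namespace PlaneCurve

/-! ### Discrete valuation rings from a local uniformizer -/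

/-- The valuation ring of a regular codimension one point `p`, inside a field of fractions that is
given by an injective homomorphism `φ`. -/
theorem exists_valuationSubring_of_uniformizer {A K : Type*} [CommRing A] [IsDomain A]
    [IsNoetherianRing A] [Field K] (φ : A →+* K) (hφ : Function.Injective φ)
    (hfrac : ∀ z : K, ∃ a b : A, z = φ a / φ b) (p : Ideal A) [p.IsPrime] {t : A} (ht0 : t ≠ 0)
    (htp : t ∈ p) (hp : ∀ a ∈ p, ∃ s ∉ p, t ∣ s * a) :
    ∃ V : ValuationSubring K, (∀ z, z ∈ V ↔ ∃ a b, b ∉ p ∧ z = φ a / φ b) ∧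
      ∀ z, V.valuation z < 1 ↔ V.valuation z ≤ V.valuation (φ t) := by
  let L := Localization.AtPrime p
  have hinj : Function.Injective (algebraMap A L) :=
    IsLocalization.injective L p.primeCompl_le_nonZeroDivisors
  have : IsDomain L := IsLocalization.isDomain_localization p.primeCompl_le_nonZeroDivisors
  have : IsNoetherianRing L := IsLocalization.isNoetherianRing p.primeCompl L inferInstance
  have hunit : ∀ s : p.primeCompl, IsUnit (φ s) := fun s => by
    refine IsUnit.mk0 _ ((map_ne_zero_iff φ hφ).2 ?_)
    intro h
    exact s.2 (h ▸ p.zero_mem)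
  let f : L →+* K := IsLocalization.lift hunit
  have hfa : ∀ a, f (algebraMap A L a) = φ a := fun a => IsLocalization.lift_eq hunit a
  have hf0 : ∀ b, b ∉ p → φ b ≠ 0 := fun b hb => (hunit ⟨b, hb⟩).ne_zero
  have hfmk : ∀ a (b : p.primeCompl), f (IsLocalization.mk' L a b) = φ a / φ b := by
    intro a b
    rw [eq_div_iff (hf0 b b.2), ← hfa b, ← map_mul, IsLocalization.mk'_spec, hfa]
  have hmax : IsLocalRing.maximalIdeal L = Ideal.span {algebraMap A L t} := by
    rw [← IsLocalization.AtPrime.map_eq_maximalIdeal p L]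
    refine le_antisymm (Ideal.map_le_iff_le_comap.2 fun a ha => ?_)
      ((Ideal.span_singleton_le_iff_mem _).2 (Ideal.mem_map_of_mem _ htp))
    obtain ⟨s, hs, hts⟩ := hp a ha
    rw [Ideal.mem_comap, Ideal.mem_span_singleton]
    have hsu : IsUnit (algebraMap A L s) :=
      IsLocalization.map_units L (⟨s, hs⟩ : p.primeCompl)
    rw [← hsu.dvd_mul_left, ← map_mul]
    exact map_dvd _ hts
  have hfield : ¬ IsField L := by
    rw [IsLocalRing.isField_iff_maximalIdeal_eq, hmax, Ideal.span_singleton_eq_bot]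
    exact (map_ne_zero_iff _ hinj).2 ht0
  -- A Noetherian local domain, not a field, with principal maximal ideal is a discrete valuation
  -- ring.
  have : ValuationRing L := ((IsDiscreteValuationRing.TFAE L hfield).out 4 1).1
    (show Submodule.IsPrincipal (IsLocalRing.maximalIdeal L) from ⟨⟨algebraMap A L t, hmax⟩⟩)
  let V : ValuationSubring K :=
    { f.range with
      mem_or_inv_mem' := fun z => by
        obtain ⟨a, b, rfl⟩ := hfrac z
        by_cases ha : a = 0
        · left; exact ⟨0, by simp [ha]⟩
        by_cases hb : b = 0
        · left; exact ⟨0, by simp [hb]⟩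
        have ha' := (map_ne_zero_iff φ hφ).2 ha
        have hb' := (map_ne_zero_iff φ hφ).2 hb
        obtain ⟨c, hc | hc⟩ := ValuationRing.cond (algebraMap A L a) (algebraMap A L b)
        · right
          refine ⟨c, ?_⟩
          rw [inv_div, eq_div_iff ha', ← hfa a, ← hfa b, ← map_mul, mul_comm, hc]
        · left
          refine ⟨c, ?_⟩
          rw [eq_div_iff hb', ← hfa a, ← hfa b, ← map_mul, mul_comm, hc] }
  have hfinj : Function.Injective f := by
    refine (injective_iff_map_eq_zero f).2 fun l hl => ?_
    obtain ⟨a, b, rfl⟩ := IsLocalization.exists_mk'_eq p.primeCompl l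
    rw [hfmk, div_eq_zero_iff, or_iff_left (hf0 b b.2), map_eq_zero_iff φ hφ] at hl
    rw [hl, IsLocalization.mk'_zero]
  have hV : ∀ z, z ∈ V ↔ ∃ l, f l = z := fun z => Iff.rfl
  have hle : ∀ l, V.valuation (f l) ≤ 1 := fun l => (V.valuation_le_one_iff _).2 ⟨l, rfl⟩
  have hlt : ∀ l, V.valuation (f l) < 1 ↔ l ∈ IsLocalRing.maximalIdeal L := by
    intro l
    rw [IsLocalRing.mem_maximalIdeal, mem_nonunits_iff]
    constructor
    · rintro h ⟨u, rfl⟩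
      have h1 : V.valuation (f u) * V.valuation (f (u⁻¹ : Lˣ)) = 1 := by
        rw [← map_mul, ← map_mul, Units.mul_inv, map_one, map_one]
      exact absurd h1 (mul_lt_one_of_lt_of_le h (hle _)).ne
    · intro h
      refine lt_of_le_of_ne (hle l) fun h1 => h ?_
      have h0 : f l ≠ 0 := fun h0 => by simp [h0] at h1
      have : V.valuation (f l)⁻¹ ≤ 1 := by rw [map_inv₀, h1, inv_one]
      obtain ⟨l', hl'⟩ := (hV _).1 ((V.valuation_le_one_iff _).1 this)
      refine IsUnit.of_mul_eq_one l' (hfinj ?_)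
      rw [map_mul, hl', mul_inv_cancel₀ h0, map_one]
  have hvt : V.valuation (φ t) < 1 := by
    rw [← hfa, hlt, hmax]
    exact Ideal.mem_span_singleton_self _
  refine ⟨V, fun z => ?_, fun z => ⟨fun h => ?_, fun h => h.trans_lt hvt⟩⟩
  · rw [hV]
    constructor
    · rintro ⟨l, rfl⟩
      obtain ⟨a, b, rfl⟩ := IsLocalization.exists_mk'_eq p.primeCompl l
      exact ⟨a, b, b.2, hfmk a b⟩
    · rintro ⟨a, b, hb, rfl⟩
      exact ⟨_, hfmk a ⟨b, hb⟩⟩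
  · obtain ⟨l, rfl⟩ := (hV _).1 ((V.valuation_le_one_iff _).1 h.le)
    rw [hlt, hmax, Ideal.mem_span_singleton] at h
    obtain ⟨l', rfl⟩ := h
    rw [map_mul, map_mul, hfa]
    exact mul_le_of_le_one_right' (hle l')

/-! ### The place at the origin -/

section Curve

variable {k : Type*} [Field k] {q₀ m : ℕ}

theorem coordY_pow : coordY k q₀ m ^ m = coordX k q₀ m ^ q₀ + coordX k q₀ m := by
  have h : eval₂ (AdjoinRoot.of (equation k q₀ m)) (coordY k q₀ m) (X ^ m - C (X ^ q₀ + X)) = 0 :=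
    AdjoinRoot.eval₂_root (equation k q₀ m)
  rw [eval₂_sub, eval₂_pow, eval₂_X, eval₂_C, map_add, map_pow, sub_eq_zero] at h
  exact h

/-- The evaluation of regular functions at the origin. -/
noncomputable def evalOrigin (k : Type*) [Field k] {q₀ m : ℕ} (hq : q₀ ≠ 0) (hm : m ≠ 0) :
    CoordinateRing k q₀ m →ₐ[k] k :=
  AdjoinRoot.liftAlgHom (equation k q₀ m) (aeval 0) 0 <| by
    rw [equation, eval₂_sub, eval₂_pow, eval₂_X, eval₂_C]
    simp [hq, hm]

theorem evalOrigin_coordX (hq : q₀ ≠ 0) (hm : m ≠ 0) :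
    evalOrigin k hq hm (coordX k q₀ m) = 0 := by
  simp [evalOrigin, coordX]

theorem evalOrigin_coordY (hq : q₀ ≠ 0) (hm : m ≠ 0) :
    evalOrigin k hq hm (coordY k q₀ m) = 0 := by
  simp [evalOrigin, coordY]

/-- Splitting off constant terms, first in `Y` and then in `X`: the maximal ideal of the origin is
generated by `x` and `y`. -/
theorem exists_eq_add_coordX_mul_add_coordY_mul (hq : q₀ ≠ 0) (hm : m ≠ 0)
    (a : CoordinateRing k q₀ m) : ∃ r s, a = algebraMap k _ (evalOrigin k hq hm a) +
      coordX k q₀ m * r + coordY k q₀ m * s := by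
  have key : ∃ c r s, a = algebraMap k _ c + coordX k q₀ m * r + coordY k q₀ m * s := by
    obtain ⟨F, rfl⟩ := AdjoinRoot.mk_surjective a
    refine ⟨(F.coeff 0).coeff 0, AdjoinRoot.of _ (F.coeff 0).divX, AdjoinRoot.mk _ F.divX, ?_⟩
    conv_lhs => rw [← F.divX_mul_X_add, ← (F.coeff 0).divX_mul_X_add]
    simp only [map_add, map_mul, AdjoinRoot.mk_X, coordX, coordY, AdjoinRoot.mk_C]
    have : algebraMap k (CoordinateRing k q₀ m) ((F.coeff 0).coeff 0) =
        AdjoinRoot.of (equation k q₀ m) (C ((F.coeff 0).coeff 0)) := rfl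
    rw [this]
    ring
  obtain ⟨c, r, s, h⟩ := key
  have hc : evalOrigin k hq hm a = c := by
    rw [h, map_add, map_add, map_mul, map_mul, evalOrigin_coordX, evalOrigin_coordY,
      AlgHom.commutes]
    simp
  exact ⟨r, s, hc ▸ h⟩

theorem coordX_mul_eq (hq : q₀ ≠ 0) :
    (1 + coordX k q₀ m ^ (q₀ - 1)) * coordX k q₀ m = coordY k q₀ m ^ m := by
  rw [coordY_pow, add_mul, one_mul, pow_sub_one_mul hq, add_comm]

/-- The factor `1 + x ^ (q₀ - 1)` takes the value `1` at the origin and turns `x` into `y ^ m`. Thus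
`y` alone generates the maximal ideal of the local ring. -/
theorem exists_coordY_dvd_mul (hq : 1 < q₀) (hm : m ≠ 0) (hq' : q₀ ≠ 0)
    {a : CoordinateRing k q₀ m} (ha : a ∈ RingHom.ker (evalOrigin k hq' hm)) :
    ∃ s ∉ RingHom.ker (evalOrigin k hq' hm), coordY k q₀ m ∣ s * a := by
  refine ⟨1 + coordX k q₀ m ^ (q₀ - 1), ?_, ?_⟩
  · rw [RingHom.mem_ker, map_add, map_one, map_pow, evalOrigin_coordX,
      zero_pow (by omega), add_zero]
    exact one_ne_zero
  · obtain ⟨r, s, h⟩ := exists_eq_add_coordX_mul_add_coordY_mul hq' hm a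
    rw [RingHom.mem_ker] at ha
    rw [ha, map_zero, zero_add] at h
    rw [h, mul_add, ← mul_assoc, coordX_mul_eq hq']
    exact dvd_add (dvd_mul_of_dvd_left (dvd_pow_self _ hm) _)
      (dvd_mul_of_dvd_right (dvd_mul_right _ _) _)

theorem Place.valuation_algebraMap_le {K : Type*} [Field K] [Algebra k K] (S : Place k K) (c : k) :
    S.ring.valuation (algebraMap k K c) ≤ 1 :=
  (S.ring.valuation_le_one_iff _).2 (S.algebraMap_mem c)

theorem Place.valuation_algebraMap {K : Type*} [Field K] [Algebra k K] (S : Place k K) {c : k}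
    (hc : c ≠ 0) : S.ring.valuation (algebraMap k K c) = 1 := by
  refine le_antisymm (S.valuation_algebraMap_le c) ?_
  have h := S.valuation_algebraMap_le c⁻¹
  rw [map_inv₀, map_inv₀] at h
  exact (inv_le_one₀ (zero_lt_iff.2 (by simpa using hc))).1 h

theorem Place.isRational_of_forall_exists {K : Type*} [Field K] [Algebra k K] (S : Place k K)
    (h : ∀ z ∈ S.ring, ∃ c : k, S.ring.valuation (z - algebraMap k K c) < 1) : S.IsRational := by
  refine ⟨S.constToResidue.injective, fun z => ?_⟩
  obtain ⟨z, rfl⟩ := IsLocalRing.residue_surjective z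
  obtain ⟨c, hc⟩ := h z z.2
  refine ⟨c, ?_⟩
  rw [Place.constToResidue, RingHom.comp_apply, eq_comm, ← sub_eq_zero, ← map_sub,
    IsLocalRing.residue_eq_zero_iff, ValuationSubring.valuation_lt_one_iff]
  exact hc

/-- The place at the origin, for a function field that is given by a homomorphism `φ`. -/
theorem exists_place_origin (hq : 1 < q₀) (hm : m ≠ 0) {K : Type*} [Field K] [Algebra k K]
    (φ : CoordinateRing k q₀ m →ₐ[k] K) (hφ : Function.Injective φ)
    (hfrac : ∀ z : K, ∃ a b, z = φ a / φ b) :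
    ∃ P : Place k K, P.IsRational ∧
      (∀ z, P.ring.valuation z < 1 ↔
        P.ring.valuation z ≤ P.ring.valuation (φ (coordY k q₀ m))) ∧
      P.ring.valuation (φ (coordX k q₀ m)) < 1 ∧
      ∀ S : Place k K, S.ring.valuation (φ (coordX k q₀ m)) < 1 →
        S.ring.valuation (φ (coordY k q₀ m)) < 1 → S = P := by
  have hq' : q₀ ≠ 0 := by omega
  have := coordinateRing_isDomain k hq hm
  have hX0 : coordX k q₀ m ≠ 0 := by
    rw [coordX, map_ne_zero_iff _ (AdjoinRoot.of.injective_of_degree_ne_zero _)]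
    · exact X_ne_zero
    · rw [equation, degree_X_pow_sub_C (by omega)]
      exact_mod_cast hm
  -- If `y = 0`, then `1 + x ^ (q₀ - 1) = 0`, although its value at the origin is `1`.
  have hY0 : coordY k q₀ m ≠ 0 := by
    intro h
    have h1 := coordX_mul_eq (k := k) (m := m) hq'
    rw [h, zero_pow hm, mul_eq_zero, or_iff_left hX0] at h1
    have h2 := congrArg (evalOrigin k hq' hm) h1
    rw [map_add, map_one, map_pow, evalOrigin_coordX, zero_pow (by omega), add_zero,
      map_zero] at h2
    exact one_ne_zero h2
  have : (RingHom.ker (evalOrigin k hq' hm : CoordinateRing k q₀ m →ₐ[k] k)).IsPrime :=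
    RingHom.ker_isPrime _
  obtain ⟨V, hV, hu⟩ := exists_valuationSubring_of_uniformizer (φ : CoordinateRing k q₀ m →+* K)
    hφ hfrac (RingHom.ker (evalOrigin k hq' hm)) hY0 (evalOrigin_coordY hq' hm)
    fun a ha => exists_coordY_dvd_mul hq hm hq' ha
  simp only [RingHom.coe_coe] at hV hu
  have hφ0 : ∀ b, b ∉ RingHom.ker (evalOrigin k hq' hm) → φ b ≠ 0 := fun b hb =>
    (map_ne_zero_iff φ hφ).2 fun h => hb (h ▸ Ideal.zero_mem _)
  have hA : ∀ a, φ a ∈ V := fun a =>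
    (hV _).2 ⟨a, 1, by simp [RingHom.mem_ker], by simp⟩
  have hle : ∀ a, V.valuation (φ a) ≤ 1 := fun a => (V.valuation_le_one_iff _).2 (hA a)
  have hYlt : V.valuation (φ (coordY k q₀ m)) < 1 := (hu _).2 le_rfl
  have hunitV : ∀ b, b ∉ RingHom.ker (evalOrigin k hq' hm) → V.valuation (φ b)⁻¹ ≤ 1 :=
    fun b hb => (V.valuation_le_one_iff _).2 ((hV _).2 ⟨1, b, hb, by simp⟩)
  have hker : ∀ a ∈ RingHom.ker (evalOrigin k hq' hm), V.valuation (φ a) < 1 := by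
    intro a ha
    obtain ⟨s, hs, r, hr⟩ := exists_coordY_dvd_mul hq hm hq' ha
    have : φ a = φ (coordY k q₀ m) * (φ r * (φ s)⁻¹) := by
      rw [← mul_assoc, ← map_mul, ← hr, map_mul, mul_comm (φ s), mul_assoc,
        mul_inv_cancel₀ (hφ0 s hs), mul_one]
    rw [this, map_mul, map_mul]
    exact mul_lt_one_of_lt_of_le hYlt (mul_le_one' (hle r) (hunitV s hs))
  let P : Place k K :=
    { ring := V
      algebraMap_mem := fun c => by rw [← φ.commutes c]; exact hA _
      ne_top := by
        intro h
        have h1 : (φ (coordY k q₀ m))⁻¹ ∈ V := h ▸ ValuationSubring.mem_top _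
        rw [← V.valuation_le_one_iff, map_inv₀, inv_le_one₀] at h1
        · exact absurd hYlt h1.not_gt
        · exact zero_lt_iff.2 ((Valuation.ne_zero_iff _).2 ((map_ne_zero_iff φ hφ).2 hY0)) }
  refine ⟨P, P.isRational_of_forall_exists ?_, hu, hker _ (evalOrigin_coordX hq' hm), ?_⟩
  · intro z hz
    obtain ⟨a, b, hb, rfl⟩ := (hV z).1 hz
    have hb0 : evalOrigin k hq' hm b ≠ 0 := hb
    -- The residue of `a / b` is the quotient of the values at the origin, since `a - c * b`
    -- vanishes there.
    refine ⟨evalOrigin k hq' hm a / evalOrigin k hq' hm b, ?_⟩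
    set c := evalOrigin k hq' hm a / evalOrigin k hq' hm b with hc
    have h1 : φ a / φ b - algebraMap k K c = φ (a - algebraMap k _ c * b) * (φ b)⁻¹ := by
      rw [map_sub, map_mul, AlgHom.commutes, sub_mul, mul_assoc, mul_inv_cancel₀ (hφ0 b hb),
        mul_one, div_eq_mul_inv]
    rw [h1, map_mul]
    refine mul_lt_one_of_lt_of_le (hker _ ?_) (hunitV b hb)
    rw [RingHom.mem_ker, map_sub, map_mul, AlgHom.commutes, Algebra.algebraMap_self_apply, hc,
      div_mul_cancel₀ _ hb0, sub_self]
  · intro S hSX hSY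
    have hSle : ∀ a, S.ring.valuation (φ a) ≤ 1 := by
      intro a
      obtain ⟨F, rfl⟩ := AdjoinRoot.mk_surjective a
      rw [S.ring.valuation_le_one_iff]
      have hof : ∀ f : k[X], φ (AdjoinRoot.of _ f) ∈ S.ring := by
        intro f
        induction f using Polynomial.induction_on' with
        | add f g hf hg => rw [map_add, map_add]; exact add_mem hf hg
        | monomial n c =>
          rw [← C_mul_X_pow_eq_monomial, map_mul, map_mul, map_pow, map_pow]
          refine mul_mem ?_ (pow_mem ((S.ring.valuation_le_one_iff _).1 hSX.le) n)
          have : AdjoinRoot.of (equation k q₀ m) (C c) = algebraMap k _ c := rfl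
          rw [this, AlgHom.commutes]
          exact S.algebraMap_mem c
      induction F using Polynomial.induction_on' with
      | add f g hf hg => rw [map_add, map_add]; exact add_mem hf hg
      | monomial n c =>
        rw [← C_mul_X_pow_eq_monomial, map_mul, map_mul, map_pow, map_pow]
        exact mul_mem (hof c) (pow_mem ((S.ring.valuation_le_one_iff _).1 hSY.le) n)
    -- Such a `b` is a nonzero constant plus an element of the maximal ideal of `S`.
    have hSunit : ∀ b, b ∉ RingHom.ker (evalOrigin k hq' hm) → S.ring.valuation (φ b) = 1 := by
      intro b hb
      obtain ⟨r, s, h⟩ := exists_eq_add_coordX_mul_add_coordY_mul hq' hm b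
      have h1 := S.valuation_algebraMap (show evalOrigin k hq' hm b ≠ 0 from hb)
      rw [h, add_assoc, map_add, AlgHom.commutes, Valuation.map_add_eq_of_lt_left, h1]
      rw [h1, map_add, map_mul, map_mul]
      refine Valuation.map_add_lt _ ?_ ?_
      · rw [map_mul]; exact mul_lt_one_of_lt_of_le hSX (hSle r)
      · rw [map_mul]; exact mul_lt_one_of_lt_of_le hSY (hSle s)
    have hVS : ∀ z, V.valuation z ≤ 1 → S.ring.valuation z ≤ 1 := by
      intro z hz
      obtain ⟨a, b, hb, rfl⟩ := (hV z).1 ((V.valuation_le_one_iff _).1 hz)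
      rw [map_div₀, hSunit b hb, div_one]
      exact hSle a
    have hring : S.ring = V := by
      ext z
      refine ⟨fun hz => ?_, fun hz =>
        (S.ring.valuation_le_one_iff _).1 (hVS z ((V.valuation_le_one_iff _).2 hz))⟩
      -- If `z` is not in `V`, then `z⁻¹` lies in `y V`, hence in the maximal ideal of `S`, so `z`
      -- is not in `S` either.
      by_contra hzV
      rw [← V.valuation_le_one_iff, not_le] at hzV
      have hz0 : z ≠ 0 := fun h => by simp [h] at hzV
      have hY0' : φ (coordY k q₀ m) ≠ 0 := (map_ne_zero_iff φ hφ).2 hY0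
      rw [V.valuation.one_lt_val_iff hz0, hu] at hzV
      have h1 : S.ring.valuation (z⁻¹ / φ (coordY k q₀ m)) ≤ 1 := by
        refine hVS _ ?_
        rw [map_div₀]
        exact div_le_one_of_le₀ hzV zero_le
      have h2 : S.ring.valuation z⁻¹ < 1 := by
        rw [← div_mul_cancel₀ z⁻¹ hY0', mul_comm, map_mul]
        exact mul_lt_one_of_lt_of_le hSY h1
      rw [← S.ring.valuation.one_lt_val_iff hz0] at h2
      exact absurd ((S.ring.valuation_le_one_iff z).2 hz) h2.not_ge
    cases S
    simp only [P, Place.mk.injEq]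
    exact hring

end Curve

end PlaneCurve

namespace PlaneCurve

/-! ### The change of coordinates that moves infinity to the origin -/

section Infinity

variable {k : Type*} [Field k] {q₀ m : ℕ}

/-- The coordinate ring is a domain integral over `k[X]`, so a nonzero kernel would meet `k[X]` in a
nonzero polynomial. -/
theorem algHom_coordinateRing_injective (hq : 1 < q₀) (hm : m ≠ 0) {K : Type*} [Field K]
    [Algebra k K] (φ : CoordinateRing k q₀ m →ₐ[k] K)
    (h : Transcendental k (φ (coordX k q₀ m))) : Function.Injective φ := by
  have := coordinateRing_isDomain k hq hm
  have hmonic : (equation k q₀ m).Monic := monic_X_pow_sub_C _ hm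
  have := hmonic.finite_adjoinRoot
  have hX : ∀ f : k[X], φ (AdjoinRoot.of _ f) = aeval (φ (coordX k q₀ m)) f := by
    intro f
    have h1 : (φ.comp (IsScalarTower.toAlgHom k k[X] (CoordinateRing k q₀ m))) =
        aeval (φ (coordX k q₀ m)) := by
      ext
      simp [coordX]
    exact DFunLike.congr_fun h1 f
  have h0 : RingHom.ker φ = ⊥ := by
    refine Ideal.eq_bot_of_comap_eq_bot (R := k[X]) ?_
    rw [eq_bot_iff]
    intro f hf
    have hf' : φ (AdjoinRoot.of _ f) = 0 := hf
    rw [hX] at hf'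
    exact (transcendental_iff.1 h) f hf'
  exact (RingHom.injective_iff_ker_eq_bot _).2 h0

theorem transcendental_coordX (hm : m ≠ 0) {K : Type*} [Field K]
    [Algebra k K] (φ : CoordinateRing k q₀ m →ₐ[k] K) (hφ : Function.Injective φ) :
    Transcendental k (φ (coordX k q₀ m)) := by
  rw [transcendental_iff]
  intro f hf
  have h1 : (φ.comp (IsScalarTower.toAlgHom k k[X] (CoordinateRing k q₀ m))) =
      aeval (φ (coordX k q₀ m)) := by
    ext
    simp [coordX]
  rw [← h1] at hf
  have h2 : AdjoinRoot.of (equation k q₀ m) f = 0 := hφ (hf.trans (map_zero φ).symm)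
  rwa [map_eq_zero_iff _ (AdjoinRoot.of.injective_of_degree_ne_zero _)] at h2
  rw [equation, degree_X_pow_sub_C (by omega)]
  exact_mod_cast hm

theorem coordinateRing_algHom_ext {B : Type*} [CommRing B] [Algebra k B]
    {φ ψ : CoordinateRing k q₀ m →ₐ[k] B} (hX : φ (coordX k q₀ m) = ψ (coordX k q₀ m))
    (hY : φ (coordY k q₀ m) = ψ (coordY k q₀ m)) : φ = ψ := by
  refine AdjoinRoot.algHom_ext' ?_ hY
  ext
  exact hX

/-- In the coordinates `1 / x`, `y / x ^ c` with `m c = q₀ + 1`, the function field is again the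
function field of the curve `Y ^ m = X ^ q₀ + X`. -/
theorem exists_algHom_inv (hq : 1 < q₀) (hm : m ≠ 0) {c : ℕ} (hc : q₀ + 1 = m * c)
    {K : Type*} [Field K] [Algebra k K] [Algebra (CoordinateRing k q₀ m) K]
    [IsScalarTower k (CoordinateRing k q₀ m) K] [IsFractionRing (CoordinateRing k q₀ m) K]
    {x y : K} (hx : x = algebraMap (CoordinateRing k q₀ m) K (coordX k q₀ m))
    (hy : y = algebraMap (CoordinateRing k q₀ m) K (coordY k q₀ m)) :
    x ≠ 0 ∧ ∃ φ : CoordinateRing k q₀ m →ₐ[k] K, φ (coordX k q₀ m) = x⁻¹ ∧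
      φ (coordY k q₀ m) = y / x ^ c ∧ Function.Injective φ ∧ ∀ z, ∃ a b, z = φ a / φ b := by
  have := coordinateRing_isDomain k hq hm
  have hx' : Transcendental k x := by
    rw [hx]
    exact transcendental_coordX hm (IsScalarTower.toAlgHom k (CoordinateRing k q₀ m) K)
      (IsFractionRing.injective _ _)
  have hx0 : x ≠ 0 := fun h => hx' (h ▸ isAlgebraic_zero)
  have hxy : y ^ m = x ^ q₀ + x := by
    rw [hx, hy, ← map_pow, coordY_pow, map_add, map_pow]
  let φ : CoordinateRing k q₀ m →ₐ[k] K :=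
    AdjoinRoot.liftAlgHom (equation k q₀ m) (aeval x⁻¹) (y / x ^ c) <| by
      rw [equation, eval₂_sub, eval₂_pow, eval₂_X, eval₂_C, div_pow, hxy, ← pow_mul, mul_comm c,
        ← hc]
      simp
      field_simp
      ring
  have hφX : φ (coordX k q₀ m) = x⁻¹ := by
    simp [φ, coordX]
  have hφY : φ (coordY k q₀ m) = y / x ^ c := by
    simp [φ, coordY]
  have hφ : Function.Injective φ := by
    refine algHom_coordinateRing_injective hq hm φ ?_
    rw [hφX]
    intro h
    exact hx' (by simpa using h.inv)
  -- The substitution `(x, y) ↦ (1 / x, y / x ^ c)` is an involution of `K`. So `σ ∘ φ` is the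
  -- inclusion, and writing `σ z` as a fraction `a / b` yields `z = φ a / φ b`.
  let σ : K →ₐ[k] K := IsFractionRing.liftAlgHom hφ
  have hσ : ∀ a, σ (algebraMap _ K a) = φ a := fun a => IsFractionRing.lift_algebraMap hφ a
  have hσx : σ x = x⁻¹ := by rw [hx, hσ, hφX, ← hx]
  have hσy : σ y = y / x ^ c := by rw [hy, hσ, hφY, ← hy]
  have hσφ : ∀ a, σ (φ a) = algebraMap _ K a := by
    intro a
    have : σ.comp φ = IsScalarTower.toAlgHom k (CoordinateRing k q₀ m) K := by
      refine coordinateRing_algHom_ext ?_ ?_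
      · rw [AlgHom.comp_apply, hφX, map_inv₀, hσx, inv_inv, hx]; rfl
      · rw [AlgHom.comp_apply, hφY, map_div₀, map_pow, hσx, hσy, inv_pow, div_inv_eq_mul,
          div_mul_cancel₀ _ (pow_ne_zero _ hx0), hy]; rfl
    exact DFunLike.congr_fun this a
  refine ⟨hx0, φ, hφX, hφY, hφ, fun z => ?_⟩
  obtain ⟨a, b, -, h⟩ := IsFractionRing.div_surjective (A := CoordinateRing k q₀ m) (σ z)
  refine ⟨a, b, σ.injective ?_⟩
  change σ z = σ (φ a / φ b)
  rw [map_div₀, hσφ, hσφ, h]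

/-! ### Points at infinity in the projective plane -/

theorem rep_mk_eq_zero_iff {L : Type*} [Field L] (v : Fin 3 → L) (hv : v ≠ 0) (i : Fin 3) :
    (Projectivization.mk L v hv).rep i = 0 ↔ v i = 0 := by
  obtain ⟨a, ha⟩ := Projectivization.exists_smul_eq_mk_rep L v hv
  rw [← ha, Pi.smul_apply, Units.smul_def, smul_eq_mul, mul_eq_zero, or_iff_right a.ne_zero]

theorem eq_mk_single_iff {L : Type*} [Field L] (R : Projectivization L (Fin 3 → L)) (i : Fin 3)
    (h : (Pi.single i 1 : Fin 3 → L) ≠ 0) :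
    R = Projectivization.mk L (Pi.single i 1) h ↔ ∀ j ≠ i, R.rep j = 0 := by
  constructor
  · rintro rfl j hj
    rw [rep_mk_eq_zero_iff, Pi.single_eq_of_ne hj]
  · intro hR
    rw [← R.mk_rep, Projectivization.mk_eq_mk_iff']
    refine ⟨R.rep i, funext fun j => ?_⟩
    by_cases hj : j = i
    · subst hj; simp
    · simp [hj, hR j hj]

theorem baseChange_mk_single (L : Type*) [Field L] [Algebra k L] (i : Fin 3)
    (h : (Pi.single i 1 : Fin 3 → k) ≠ 0) (h' : (Pi.single i 1 : Fin 3 → L) ≠ 0) :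
    baseChange k L (Projectivization.mk k (Pi.single i 1) h) =
      Projectivization.mk L (Pi.single i 1) h' := by
  refine (Projectivization.map_mk _ _ _ h).trans ?_
  congr 1
  funext j
  change algebraMap k L _ = _
  by_cases hj : j = i
  · subst hj; simp
  · simp [hj]

/-- On `Z = 0` only the leading form survives, here `-X ^ q₀`. -/
theorem isPointAtInfinity_iff_of_lt (hq : 1 < q₀) (h : m < q₀)
    (R : Projectivization k (Fin 3 → k)) :
    IsPointAtInfinity q₀ m R ↔ R.rep 0 = 0 ∧ R.rep 2 = 0 := by
  rw [IsPointAtInfinity, and_congr_left_iff]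
  intro h2
  have h1 : q₀ - m ≠ 0 := by omega
  have h3 : q₀ - 1 ≠ 0 := by omega
  have h4 : q₀ ≠ 0 := by omega
  simp [homogeneousEquation, max_eq_right h.le, h2, h1, h3, h4]

/-- The leading form is now `Y ^ m`. -/
theorem isPointAtInfinity_iff_of_gt (hq : 1 < q₀) (h : q₀ < m)
    (R : Projectivization k (Fin 3 → k)) :
    IsPointAtInfinity q₀ m R ↔ R.rep 1 = 0 ∧ R.rep 2 = 0 := by
  rw [IsPointAtInfinity, and_congr_left_iff]
  intro h2
  have h1 : m - q₀ ≠ 0 := by omega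
  have h3 : m - 1 ≠ 0 := by omega
  have h4 : m ≠ 0 := by omega
  simp [homogeneousEquation, max_eq_left h.le, h2, h1, h3, h4]

/-- There is exactly one place with a pole of `x`; it is rational, and the orders of `x` and `y` at
this place are `-m` and `-q₀`. -/
theorem exists_place_infinity (hq : 1 < q₀) (hm : m ∣ q₀ + 1)
    {K : Type*} [Field K] [Algebra k K] [Algebra (CoordinateRing k q₀ m) K]
    [IsScalarTower k (CoordinateRing k q₀ m) K] [IsFractionRing (CoordinateRing k q₀ m) K]
    {x y : K} (hx : x = algebraMap (CoordinateRing k q₀ m) K (coordX k q₀ m))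
    (hy : y = algebraMap (CoordinateRing k q₀ m) K (coordY k q₀ m)) :
    ∃ P : Place k K, P.IsRational ∧ P.HasOrd x (-(m : ℤ)) ∧ P.HasOrd y (-(q₀ : ℤ)) ∧
      ∀ S : Place k K, 1 < S.ring.valuation x → S = P := by
  obtain ⟨c, hc⟩ := hm
  have hm : m ≠ 0 := fun h => by simp [h] at hc
  obtain ⟨hx0, φ, hφX, hφY, hφ, hfrac⟩ := exists_algHom_inv hq hm hc hx hy
  obtain ⟨P, hrat, hu, hPX, huniq⟩ := exists_place_origin hq hm φ hφ hfrac
  have htm : (y / x ^ c) ^ m = x⁻¹ ^ q₀ + x⁻¹ := by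
    rw [← hφX, ← hφY, ← map_pow, coordY_pow, map_add, map_pow]
  have hvt : ∀ S : Place k K, S.ring.valuation x⁻¹ < 1 →
      S.ring.valuation (y / x ^ c) ^ m = S.ring.valuation x⁻¹ := by
    intro S hS
    have hmul : x⁻¹ ^ q₀ + x⁻¹ = x⁻¹ * (1 + x⁻¹ ^ (q₀ - 1)) := by
      rw [mul_add, mul_one, mul_pow_sub_one (by omega), add_comm]
    rw [← map_pow, htm, hmul, map_mul, Valuation.map_one_add_of_lt, mul_one]
    rw [map_pow]
    exact pow_lt_one₀ zero_le hS (by omega)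
  rw [hφY] at hu huniq
  rw [hφX] at hPX huniq
  have htP := hvt P hPX
  have hvx : P.ring.valuation x = P.ring.valuation (y / x ^ c) ^ (-(m : ℤ)) := by
    rw [zpow_neg, zpow_natCast, htP, map_inv₀, inv_inv]
  have ht0 : y / x ^ c ≠ 0 := by
    intro h
    rw [h, map_zero, zero_pow hm, eq_comm, Valuation.zero_iff] at htP
    exact inv_ne_zero hx0 htP
  have hτ : P.ring.valuation (y / x ^ c) ≠ 0 := (Valuation.ne_zero_iff _).2 ht0
  refine ⟨P, hrat, ⟨_, ht0, hu, hvx⟩, ⟨_, ht0, hu, ?_⟩, fun S hS => ?_⟩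
  · have hy' : y = y / x ^ c * x ^ c := (div_mul_cancel₀ _ (pow_ne_zero _ hx0)).symm
    conv_lhs => rw [hy']
    rw [map_mul, map_pow, hvx, ← zpow_natCast (_ ^ (-(m : ℤ))), ← zpow_mul, ← zpow_one_add₀ hτ]
    congr 1
    have : (q₀ : ℤ) + 1 = m * c := by exact_mod_cast hc
    linarith
  · rw [S.ring.valuation.one_lt_val_iff hx0] at hS
    refine huniq S hS ?_
    rw [← pow_lt_one_iff_of_nonneg zero_le hm, hvt S hS]
    exact hS

theorem Place.HasOrd.ne_zero_and_valuation_div_lt_one {K : Type*} [Field K] [Algebra k K]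
    {P : Place k K} {f g : K} {n n' : ℤ} (hf : P.HasOrd f n) (hg : P.HasOrd g n') (h : n' < n) :
    g ≠ 0 ∧ P.ring.valuation (f / g) < 1 := by
  obtain ⟨t, ht, hu, hft⟩ := hf
  obtain ⟨s, hs, hu', hgs⟩ := hg
  have hst : P.ring.valuation s = P.ring.valuation t :=
    le_antisymm ((hu s).1 ((hu' s).2 le_rfl)) ((hu' t).1 ((hu t).2 le_rfl))
  have h0 : P.ring.valuation t ≠ 0 := (Valuation.ne_zero_iff _).2 ht
  constructor
  · rintro rfl
    rw [map_zero, hst, eq_comm] at hgs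
    exact zpow_ne_zero _ h0 hgs
  · rw [map_div₀, hft, hgs, hst, ← zpow_sub₀ h0]
    exact zpow_lt_one₀ (zero_lt_iff.2 h0) ((hu t).2 le_rfl) (by omega)

theorem Place.HasOrd.one {K : Type*} [Field K] [Algebra k K]
    {P : Place k K} {f : K} {n : ℤ} (hf : P.HasOrd f n) : P.HasOrd 1 0 := by
  obtain ⟨t, ht, hu, -⟩ := hf
  exact ⟨t, ht, hu, by simp⟩

/-- A centre on `Z = 0` forces `g` to vanish at the place, so a coordinate function whose
homogeneous coordinate is nonzero has a pole. -/
theorem Place.one_lt_valuation_of_mul_sub_lt_one {K : Type*} [Field K] [Algebra k K] {S : Place k K}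
    {g f : K} {c : k} (hc : c ≠ 0) (hg : S.ring.valuation g < 1)
    (h : S.ring.valuation (g * f - algebraMap k K c) < 1) : 1 < S.ring.valuation f := by
  have hc' := S.valuation_algebraMap hc
  have h1 : S.ring.valuation (g * f) = 1 := by
    rw [← sub_add_cancel (g * f) (algebraMap k K c), Valuation.map_add_eq_of_lt_right, hc']
    rwa [hc']
  by_contra h2
  rw [map_mul] at h1
  exact (mul_lt_one_of_lt_of_le hg (not_lt.1 h2)).ne h1

end Infinity

end PlaneCurve

/-! ### The place centred at the point at infinity -/

theorem propositionn3 (q₀ m : ℕ) (hq₀ : IsPrimePow q₀) (hm : m ∣ q₀ + 1)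
    {k : Type*} [Field k] [Finite k] (hk : Nat.card k = q₀ ^ 2)
    {K : Type*} [Field K] [Algebra k K]
    [Algebra (PlaneCurve.CoordinateRing k q₀ m) K]
    [IsScalarTower k (PlaneCurve.CoordinateRing k q₀ m) K]
    [IsFractionRing (PlaneCurve.CoordinateRing k q₀ m) K]
    (x y : K)
    (hx : x = algebraMap (PlaneCurve.CoordinateRing k q₀ m) K (PlaneCurve.coordX k q₀ m))
    (hy : y = algebraMap (PlaneCurve.CoordinateRing k q₀ m) K (PlaneCurve.coordY k q₀ m)) :
    ∃ Q : Projectivization k (Fin 3 → k),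
      (∀ R : Projectivization (AlgebraicClosure k) (Fin 3 → AlgebraicClosure k),
        PlaneCurve.IsPointAtInfinity q₀ m R ↔
          R = PlaneCurve.baseChange k (AlgebraicClosure k) Q) ∧
      ∃ P : PlaneCurve.Place k K,
        (∀ S : PlaneCurve.Place k K, S.IsRational ∧ S.IsCentredAt x y Q ↔ S = P) ∧
        P.HasOrd x (-(m : ℤ)) ∧ P.HasOrd y (-(q₀ : ℤ)) := by
  have hq : 1 < q₀ := hq₀.one_lt
  obtain ⟨P, hrat, hPx, hPy, huniq⟩ := PlaneCurve.exists_place_infinity hq hm hx hy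
  have hm0 : m ≠ 0 := fun h => by simp [h] at hm
  have hP1 := hPx.one
  have hxy : y ^ m = x ^ q₀ + x := by
    rw [hx, hy, ← map_pow, PlaneCurve.coordY_pow, map_add, map_pow]
  have hne : ∀ (L : Type _) [Field L] (i : Fin 3), (Pi.single i 1 : Fin 3 → L) ≠ 0 :=
    fun L _ i => Pi.single_ne_zero_iff.2 one_ne_zero
  have hrep : ∀ i, (Projectivization.mk k (Pi.single i 1) (hne k i)).rep i ≠ 0 := fun i => by
    rw [Ne, PlaneCurve.rep_mk_eq_zero_iff]
    simp
  have hrep' : ∀ i j, j ≠ i → (Projectivization.mk k (Pi.single i 1) (hne k i)).rep j = 0 :=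
    fun i j hj => by rw [PlaneCurve.rep_mk_eq_zero_iff, Pi.single_eq_of_ne hj]
  -- Equality would make `q₀` divide `1`.
  have hcase : m < q₀ ∨ q₀ < m := by
    refine lt_or_gt_of_ne fun h => ?_
    rw [h, Nat.dvd_add_right dvd_rfl, Nat.dvd_one] at hm
    omega
  obtain h | h := hcase
  · refine ⟨Projectivization.mk k (Pi.single 1 1) (hne k 1), fun R => ?_, P, fun S => ?_, hPx, hPy⟩
    · rw [PlaneCurve.baseChange_mk_single _ _ _ (hne _ 1), PlaneCurve.eq_mk_single_iff,
        PlaneCurve.isPointAtInfinity_iff_of_lt hq h]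
      simp [Fin.forall_fin_succ]
    · constructor
      · rintro ⟨-, g, -, hg1, hg2⟩
        rw [hrep' 1 2 (by decide), map_zero, sub_zero] at hg2
        have hvy := PlaneCurve.Place.one_lt_valuation_of_mul_sub_lt_one (hrep 1) hg2 hg1
        -- The centre only gives a pole of `y`; without a pole of `x`, `y ^ m = x ^ q₀ + x` would be
        -- regular.
        refine huniq S (not_le.1 fun hvx => ?_)
        have h1 : 1 < S.ring.valuation (y ^ m) := by
          rw [map_pow]
          exact one_lt_pow₀ hvy hm0
        rw [hxy] at h1
        refine absurd h1 (not_lt.2 (Valuation.map_add_le _ ?_ hvx))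
        rw [map_pow]
        exact pow_le_one₀ zero_le hvx
      · rintro rfl
        obtain ⟨hy0, hxlt⟩ := hPx.ne_zero_and_valuation_div_lt_one hPy (by omega)
        obtain ⟨-, hylt⟩ := hP1.ne_zero_and_valuation_div_lt_one hPy (by omega)
        set d := (Projectivization.mk k (Pi.single 1 1) (hne k 1)).rep 1 with hd
        have hdv := S.valuation_algebraMap_le d
        -- Scaling by `d / y` matches the chosen representative `(0, d, 0)`; `x / y` and `1 / y`
        -- have positive orders `q₀ - m` and `q₀`.
        refine ⟨hrat, algebraMap k K d / y, ?_, ?_, ?_⟩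
        · rw [hrep' 1 0 (by decide), map_zero, sub_zero, div_mul_eq_mul_div, mul_div_assoc, map_mul]
          exact (mul_comm _ _).trans_lt (mul_lt_one_of_lt_of_le hxlt hdv)
        · rw [← hd, div_mul_cancel₀ _ hy0, sub_self, map_zero]
          exact zero_lt_one
        · rw [hrep' 1 2 (by decide), map_zero, sub_zero, ← mul_one_div, map_mul]
          exact (mul_comm _ _).trans_lt (mul_lt_one_of_lt_of_le hylt hdv)
  · refine ⟨Projectivization.mk k (Pi.single 0 1) (hne k 0), fun R => ?_, P, fun S => ?_, hPx, hPy⟩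
    · rw [PlaneCurve.baseChange_mk_single _ _ _ (hne _ 0), PlaneCurve.eq_mk_single_iff,
        PlaneCurve.isPointAtInfinity_iff_of_gt hq h]
      simp [Fin.forall_fin_succ]
    · constructor
      · rintro ⟨-, g, hg0, -, hg2⟩
        rw [hrep' 0 2 (by decide), map_zero, sub_zero] at hg2
        exact huniq S (PlaneCurve.Place.one_lt_valuation_of_mul_sub_lt_one (hrep 0) hg2 hg0)
      · rintro rfl
        obtain ⟨hx0, hylt⟩ := hPy.ne_zero_and_valuation_div_lt_one hPx (by omega)
        obtain ⟨-, hxlt⟩ := hP1.ne_zero_and_valuation_div_lt_one hPx (by omega)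
        set d := (Projectivization.mk k (Pi.single 0 1) (hne k 0)).rep 0 with hd
        have hdv := S.valuation_algebraMap_le d
        -- Here `y / x` and `1 / x` have positive orders `m - q₀` and `m`.
        refine ⟨hrat, algebraMap k K d / x, ?_, ?_, ?_⟩
        · rw [← hd, div_mul_cancel₀ _ hx0, sub_self, map_zero]
          exact zero_lt_one
        · rw [hrep' 0 1 (by decide), map_zero, sub_zero, div_mul_eq_mul_div, mul_div_assoc, map_mul]
          exact (mul_comm _ _).trans_lt (mul_lt_one_of_lt_of_le hylt hdv)
        · rw [hrep' 0 2 (by decide), map_zero, sub_zero, ← mul_one_div, map_mul]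
          exact (mul_comm _ _).trans_lt (mul_lt_one_of_lt_of_le hxlt hdv)
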